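/- An \emph{individual flow graph} $\Phi_i$ is a finite directed graph embedded in a connected closed (not necessarily orientable) surface $\overline{S}_i$, whose vertices are called \emph{joints}, together with a sign (positive or negative) and a coorientation on each edge, such that: \begin{itemize} \item each joint is either inward or outward, and each edge goes from an inward joint to an outward joint; \item each component of the complement of $\Phi_i$ is an open disc bounded by four sides (a \emph{quadrilateral}; its four sides need not be four distinct edges and its four corners need not lie at four distinct joints), the signs of the sides alternate around each quadrilateral, and of any two opposite sides of a quadrilateral one is cooriented into it and the other out of it. \end{itemize} (These are the duals of the spine graphs of totally periodic Anosov flows with orientable stable and unstable foliations.) Each quadrilateral $Q$ has two inward corners and two outward corners. We say that $Q$ is \emph{free} if its two inward corners lie at distinct joints and its two outward corners lie at distinct joints; \emph{outwardly rigid} if the two inward joints are distinct and the two outward joints are the same; \emph{inwardly rigid} if the two inward joints are the same and the two outward joints are distinct; \emph{totally rigid} if the two inward joints are the same and the two outward joints are the same. The flow graph (1QP) is obtained from one square, with corners alternately inward and outward and sides alternately positive and negative, by gluing each side to the opposite side by the antipodal map of the boundary; its surface is the projective plane. The flow graph (2QS) is obtained from two copies of such a square by gluing their boundaries by the identity; its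 surface is the sphere. Being a (1QP) or a (2QS) means agreeing with this model up to a homeomorphism of surfaces that preserves the directions and signs of edges. Let $\Phi_i$ be an individual flow graph. Then at least one of the following statements is true: \begin{enumerate} \item $\Phi_i$ is a (1QP). \item $\Phi_i$ is a (2QS). \item There is an embedded cycle of $\Phi_i$ (a closed edge path with pairwise distinct edges and pairwise distinct joints, whose edges may be traversed in either direction) that is coorientable, i.e. two-sided in $\overline{S}_i$, and consists of edges of the same sign. \item There is a free quadrilateral in the complement of $\Phi_i$ in $\overline{S}_i$. \item There are an outwardly rigid quadrilateral $Q_+$ and an inwardly rigid quadrilateral $Q_-$ in the complement of $\Phi_i$ in $\overline{S}_i$ that share a side. \item ($\Phi_i$ is outwardly rigid.) All quadrilaterals are outwardly or totally rigid, there is at least one outwardly rigid quadrilateral, and there is exactly one outward joint but at least two inward joints in $\overline{S}_i$. \item ($\Phi_i$ is inwardly rigid.) All quadrilaterals are inwardly or totally rigid, there is at least one inwardly rigid quadrilateral, and there is exactly one inward joint but at least two outward joints in $\overline{S}_i$. \end{enumerate} -/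

import Mathlib

/-- An individual flow graph: a connected closed surface cut into quadrilaterals by an embedded
directed graph with signed and cooriented edges, recorded by its flags.

A flag is a triple (joint, edge, quadrilateral), each incident to the next (an edge is taken
with one of its two ends, a quadrilateral with one of its corners or sides). `τ₀`, `τ₁`, `τ₂`
pass to the neighbouring flag that differs in the joint, in the edge, in the quadrilateral
respectively. So the joints, edges and quadrilaterals are the orbits of `⟨τ₁, τ₂⟩`, `⟨τ₀, τ₂⟩`
and `⟨τ₀, τ₁⟩`. The surface is recovered by gluing squares along their sides by `τ₂`; it has no
boundary (by `into_τ₂`, the map `τ₂` has no fixed point) and need not be orientable.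

It is the dual of a spine graph: a quadrilateral is a 4-valent vertex, an edge is a dual edge,
and a joint is a collapsed boundary component of the base surface. -/
structure FlowGraph (F : Type*) where
  finite : Finite F
  nonempty : Nonempty F
  τ₀ : F → F
  τ₁ : F → F
  τ₂ : F → F
  τ₀_τ₀ : ∀ f, τ₀ (τ₀ f) = f
  τ₁_τ₁ : ∀ f, τ₁ (τ₁ f) = f
  τ₂_τ₂ : ∀ f, τ₂ (τ₂ f) = f
  τ₀_τ₂ : ∀ f, τ₀ (τ₂ f) = τ₂ (τ₀ f)
  /-- The surface is connected. -/
  connected : ∀ f g, Relation.EqvGen (fun x y => y = τ₀ x ∨ y = τ₁ x ∨ y = τ₂ x) f g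
  /-- Every complementary region has four sides. -/
  quad_closed : ∀ f, (fun x => τ₁ (τ₀ x))^[4] f = f
  quad_not_bigon : ∀ f, (fun x => τ₁ (τ₀ x))^[2] f ≠ f
  /-- Whether the joint of the flag is inward (`true`) or outward (`false`). Every edge has one
  inward and one outward end, and is directed from its inward to its outward end. -/
  inward : F → Bool
  inward_τ₀ : ∀ f, inward (τ₀ f) = !inward f
  inward_τ₁ : ∀ f, inward (τ₁ f) = inward f
  inward_τ₂ : ∀ f, inward (τ₂ f) = inward f
  /-- Whether the edge of the flag is positive (`true`) or negative (`false`). The signs of the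
  sides alternate around every quadrilateral. -/
  positive : F → Bool
  positive_τ₀ : ∀ f, positive (τ₀ f) = positive f
  positive_τ₁ : ∀ f, positive (τ₁ f) = !positive f
  positive_τ₂ : ∀ f, positive (τ₂ f) = positive f
  /-- Whether the edge of the flag is cooriented into (`true`) or out of (`false`) the
  quadrilateral of the flag. Of two opposite sides of a quadrilateral, one is cooriented into it
  and the other is cooriented out of it. -/
  into : F → Bool
  into_τ₀ : ∀ f, into (τ₀ f) = into f
  into_τ₂ : ∀ f, into (τ₂ f) = !into f
  into_opposite : ∀ f, into (τ₁ (τ₀ (τ₁ f))) = !into f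

namespace FlowGraph

variable {F : Type*} (Φ : FlowGraph F)

/-- The joints, that is, the vertices of the flow graph. -/
def Joint : Type _ := Quot (fun x y : F => y = Φ.τ₁ x ∨ y = Φ.τ₂ x)

/-- The edges of the flow graph. -/
def Edge : Type _ := Quot (fun x y : F => y = Φ.τ₀ x ∨ y = Φ.τ₂ x)

/-- The quadrilaterals, that is, the complementary regions of the flow graph. -/
def Quad : Type _ := Quot (fun x y : F => y = Φ.τ₀ x ∨ y = Φ.τ₁ x)

def joint (f : F) : Φ.Joint := Quot.mk _ f

def edge (f : F) : Φ.Edge := Quot.mk _ f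

def quad (f : F) : Φ.Quad := Quot.mk _ f

/-- The set of inward joints. -/
def inwardJoints : Set Φ.Joint := {j | ∃ f, Φ.joint f = j ∧ Φ.inward f = true}

/-- The set of outward joints. -/
def outwardJoints : Set Φ.Joint := {j | ∃ f, Φ.joint f = j ∧ Φ.inward f = false}

/-- The inward joints that lie on the boundary of a quadrilateral (one or two). -/
def inwardJointsOf (Q : Φ.Quad) : Set Φ.Joint :=
  {j | ∃ f, Φ.quad f = Q ∧ Φ.joint f = j ∧ Φ.inward f = true}

/-- The outward joints that lie on the boundary of a quadrilateral (one or two). -/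
def outwardJointsOf (Q : Φ.Quad) : Set Φ.Joint :=
  {j | ∃ f, Φ.quad f = Q ∧ Φ.joint f = j ∧ Φ.inward f = false}

def IsFree (Q : Φ.Quad) : Prop :=
  (Φ.inwardJointsOf Q).Nontrivial ∧ (Φ.outwardJointsOf Q).Nontrivial

def IsOutwardlyRigidQuad (Q : Φ.Quad) : Prop :=
  (Φ.inwardJointsOf Q).Nontrivial ∧ (Φ.outwardJointsOf Q).Subsingleton

def IsInwardlyRigidQuad (Q : Φ.Quad) : Prop :=
  (Φ.inwardJointsOf Q).Subsingleton ∧ (Φ.outwardJointsOf Q).Nontrivial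

def IsTotallyRigidQuad (Q : Φ.Quad) : Prop :=
  (Φ.inwardJointsOf Q).Subsingleton ∧ (Φ.outwardJointsOf Q).Subsingleton

/-- Two quadrilaterals share a side: they lie on the two sides of some edge. -/
def ShareSide (Q Q' : Φ.Quad) : Prop := ∃ f, Φ.quad f = Q ∧ Φ.quad (Φ.τ₂ f) = Q'

/-- The flow graph is outwardly rigid. -/
def IsOutwardlyRigid : Prop :=
  (∀ Q, Φ.IsOutwardlyRigidQuad Q ∨ Φ.IsTotallyRigidQuad Q) ∧
  (∃ Q, Φ.IsOutwardlyRigidQuad Q) ∧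
  Φ.outwardJoints.ncard = 1 ∧ 2 ≤ Φ.inwardJoints.ncard

/-- The flow graph is inwardly rigid. -/
def IsInwardlyRigid : Prop :=
  (∀ Q, Φ.IsInwardlyRigidQuad Q ∨ Φ.IsTotallyRigidQuad Q) ∧
  (∃ Q, Φ.IsInwardlyRigidQuad Q) ∧
  Φ.inwardJoints.ncard = 1 ∧ 2 ≤ Φ.outwardJoints.ncard

/-- The closed edge path of length `n` whose `k`-th edge is that of the flag `c k`, traversed
from the joint of `c k` to its other end, is an embedded cycle: it is closed up, and its joints
and its edges are pairwise distinct. The quadrilateral of `c k` plays no role. -/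
def IsEmbeddedCycle {n : ℕ} (c : ZMod n → F) : Prop :=
  0 < n ∧ (∀ k, Φ.joint (Φ.τ₀ (c k)) = Φ.joint (c (k + 1))) ∧
  Function.Injective (fun k => Φ.joint (c k)) ∧ Function.Injective (fun k => Φ.edge (c k))

/-- Starting on the edge of the flag `a`, one turns around the joint of `a` through the
quadrilateral of `a` and then through successive quadrilaterals, and arrives at the edge of `b`
through the quadrilateral of `b`. In other words, on a path that enters the joint along the edge
of `a` and leaves it along the edge of `b` (another edge), the quadrilaterals of `a` and `b` lie
on the same side. -/
def SameSide (a b : F) : Prop := ∃ j : ℕ, b = (fun x => Φ.τ₁ (Φ.τ₂ x))^[j] (Φ.τ₁ a)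

/-- A cycle is coorientable if one can choose a side of each of its edges (given by the
quadrilateral of the flag `s k` on that edge), so that consecutive choices lie on the same side
of the cycle at the joint between them. -/
def IsCoorientable {n : ℕ} (c : ZMod n → F) : Prop :=
  ∃ s : ZMod n → F, (∀ k, s k = c k ∨ s k = Φ.τ₂ (c k)) ∧
    ∀ k, Φ.SameSide (Φ.τ₀ (s k)) (s (k + 1))

/-- There is an embedded and coorientable cycle that consists of edges of the same sign. -/
def HasCoorientableCycle : Prop :=
  ∃ (n : ℕ) (c : ZMod n → F), Φ.IsEmbeddedCycle c ∧ Φ.IsCoorientable c ∧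
    ∀ k l, Φ.positive (c k) = Φ.positive (c l)

/-- Two flow graphs are the same up to a homeomorphism of surfaces that respects the directions
and the signs of the edges. -/
def Iso {F' : Type*} (Φ : FlowGraph F) (Φ' : FlowGraph F') : Prop :=
  ∃ e : F ≃ F', (∀ f, e (Φ.τ₀ f) = Φ'.τ₀ (e f)) ∧ (∀ f, e (Φ.τ₁ f) = Φ'.τ₁ (e f)) ∧
    (∀ f, e (Φ.τ₂ f) = Φ'.τ₂ (e f)) ∧ (∀ f, Φ'.inward (e f) = Φ.inward f) ∧
    (∀ f, Φ'.positive (e f) = Φ.positive f)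

/-- The eight flags of a square in cyclic order: `0, 1` lie on the first side, `2, 3` on the
second, `4, 5` on the third, `6, 7` on the fourth. This is the passage to the other end of the
side. -/
def sq₀ (x : Fin 8) : Fin 8 := if x.val % 2 = 0 then x + 1 else x - 1

/-- The passage to the other side at the same corner of the square. -/
def sq₁ (x : Fin 8) : Fin 8 := if x.val % 2 = 0 then x - 1 else x + 1

theorem sq_connected (x : Fin 8) :
    Relation.EqvGen (fun x y => y = sq₀ x ∨ y = sq₁ x) 0 x := by
  have step : ∀ y : Fin 8, Relation.EqvGen (fun x y => y = sq₀ x ∨ y = sq₁ x) y (y + 1) := by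
    intro y
    refine Relation.EqvGen.rel _ _ ?_
    revert y
    decide
  have h : ∀ n : ℕ, ∀ hn : n < 8,
      Relation.EqvGen (fun x y => y = sq₀ x ∨ y = sq₁ x) 0 (⟨n, hn⟩ : Fin 8) := by
    intro n
    induction n with
    | zero => intro _; exact Relation.EqvGen.refl _
    | succ k ih =>
      intro hk
      have h1 := (ih (by omega)).trans _ _ _ (step ⟨k, by omega⟩)
      have h2 : (⟨k, by omega⟩ : Fin 8) + 1 = ⟨k + 1, hk⟩ := by
        ext
        simp [Fin.val_add]
        omega
      rwa [h2] at h1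
  exact h x.val x.isLt

/-- (1QP): one square, each side glued to the opposite one by the antipodal map of the boundary.
The surface is the projective plane. -/
def oneQP : FlowGraph (Fin 8) where
  finite := inferInstance
  nonempty := inferInstance
  τ₀ := sq₀
  τ₁ := sq₁
  τ₂ x := x + 4
  τ₀_τ₀ := by decide
  τ₁_τ₁ := by decide
  τ₂_τ₂ := by decide
  τ₀_τ₂ := by decide
  connected f g := by
    have h : ∀ x, Relation.EqvGen (fun x y => y = sq₀ x ∨ y = sq₁ x ∨ y = x + 4) 0 x :=
      fun x => (sq_connected x).mono (fun a b hab => by tauto)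
    exact ((h f).symm _ _).trans _ _ _ (h g)
  quad_closed := by decide
  quad_not_bigon := by decide
  inward x := x.val % 4 = 0 ∨ x.val % 4 = 3
  inward_τ₀ := by decide
  inward_τ₁ := by decide
  inward_τ₂ := by decide
  positive x := x.val % 4 < 2
  positive_τ₀ := by decide
  positive_τ₁ := by decide
  positive_τ₂ := by decide
  into x := x.val < 4
  into_τ₀ := by decide
  into_τ₂ := by decide
  into_opposite := by decide

/-- (2QS): two squares glued along their boundaries by the identity. The surface is the sphere. -/
def twoQS : FlowGraph (Fin 8 × Bool) where
  finite := inferInstance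
  nonempty := inferInstance
  τ₀ x := (sq₀ x.1, x.2)
  τ₁ x := (sq₁ x.1, x.2)
  τ₂ x := (x.1, !x.2)
  τ₀_τ₀ := by decide
  τ₁_τ₁ := by decide
  τ₂_τ₂ := by decide
  τ₀_τ₂ := by decide
  connected f g := by
    have h : ∀ x : Fin 8 × Bool, Relation.EqvGen (fun x y : Fin 8 × Bool =>
        y = (sq₀ x.1, x.2) ∨ y = (sq₁ x.1, x.2) ∨ y = (x.1, !x.2)) (0, false) x := by
      have h0 : ∀ a b : Fin 8, Relation.EqvGen (fun x y => y = sq₀ x ∨ y = sq₁ x) a b →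
          Relation.EqvGen (fun x y : Fin 8 × Bool =>
            y = (sq₀ x.1, x.2) ∨ y = (sq₁ x.1, x.2) ∨ y = (x.1, !x.2)) (a, false) (b, false) := by
        intro a b hab
        induction hab with
        | rel a b hab =>
          refine Relation.EqvGen.rel _ _ ?_
          rcases hab with rfl | rfl <;> simp
        | refl a => exact Relation.EqvGen.refl _
        | symm a b _ ih => exact ih.symm _ _
        | trans a b c _ _ ih1 ih2 => exact ih1.trans _ _ _ ih2
      rintro ⟨x, b⟩
      cases b with
      | false => exact h0 0 x (sq_connected x)
      | true => exact (h0 0 x (sq_connected x)).trans _ _ _ (Relation.EqvGen.rel _ _ (by simp))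
    exact ((h f).symm _ _).trans _ _ _ (h g)
  quad_closed := by decide
  quad_not_bigon := by decide
  inward x := x.1.val % 4 = 0 ∨ x.1.val % 4 = 3
  inward_τ₀ := by decide
  inward_τ₁ := by decide
  inward_τ₂ := by decide
  positive x := x.1.val % 4 < 2
  positive_τ₀ := by decide
  positive_τ₁ := by decide
  positive_τ₂ := by decide
  into x := (x.1.val < 4 : Bool) ^^ x.2
  into_τ₀ := by decide
  into_τ₂ := by decide
  into_opposite := by decide

end FlowGraph

/-!
Write `σ` for the antipode of a quadrilateral, which sends a flag to the one of the same kind on the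
opposite side, at the opposite corner. Suppose that there is no embedded coorientable cycle
consisting of edges of one sign.

Two edges of one sign that join the joints `a` and `b` form an embedded cycle, which has to be
one-sided. As one of any three such cycles formed by three edges is two-sided, at most two edges of
each sign join `a` to `b` (`mem_of_parallel`). This has two consequences.

* If some edge has the same quadrilateral on both sides, with its two flags there exchanged by `σ`,
  then this quadrilateral is a Möbius band with respect to that edge, and its remaining two sides
  form the boundary of this band, a two-sided cycle unless they coincide. So they are also glued
  by `σ`, and the flow graph is a (1QP) (`iso_oneQP`).
* Otherwise the four sides of a totally rigid quadrilateral `T` are all the edges between its two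
  joints. A neighbour `Q` of `T` with a single outward joint, say, has two such edges, adjacent at
  an inward corner, so it is glued to two sides of `T`. These are not adjacent at an inward corner,
  since otherwise the joint there would be surrounded by just one corner of `T` and one of `Q`
  (`rot_eq_of_neighbour`). So turning around the joint takes the flag of `T` at one end of that side
  to its image under `σ`: the two inward corners of `T` have the same local orientation. If a
  neighbour of `T` across the same or the opposite side has a single
  inward joint, the outward corners do likewise, and a pair of opposite sides of `T` is two-sided.
  Thus no two totally rigid quadrilaterals are adjacent, and none has both an outwardly and an
  inwardly rigid neighbour.

If moreover no quadrilateral is free and no outwardly rigid one is next to an inwardly rigid one,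
the presence of one outwardly rigid quadrilateral propagates over the connected surface, so that all
quadrilaterals have a single outward joint (`isOutwardlyRigid_of_exists`). Inward rigidity is
obtained by reversing all edges, and one of the two kinds exists because adjacent quadrilaterals are
not both totally rigid.
-/

namespace FlowGraph

variable {F : Type*} (Φ : FlowGraph F)

/-! ### Quadrilaterals, edges and joints in terms of flags -/

/-- The opposite flag of the same quadrilateral: on the opposite side, at the opposite corner. -/
def antipode (f : F) : F := Φ.τ₁ (Φ.τ₀ (Φ.τ₁ (Φ.τ₀ f)))

theorem antipode_antipode (f : F) : Φ.antipode (Φ.antipode f) = f := Φ.quad_closed f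

theorem antipode_ne (f : F) : Φ.antipode f ≠ f := Φ.quad_not_bigon f

theorem antipode_eq_reverse (f : F) : Φ.antipode f = Φ.τ₀ (Φ.τ₁ (Φ.τ₀ (Φ.τ₁ f))) := by
  have h := Φ.antipode_antipode (Φ.τ₀ (Φ.τ₁ (Φ.τ₀ (Φ.τ₁ f))))
  simpa [antipode, Φ.τ₀_τ₀, Φ.τ₁_τ₁] using h

theorem antipode_τ₀ (f : F) : Φ.antipode (Φ.τ₀ f) = Φ.τ₀ (Φ.antipode f) := by
  rw [Φ.antipode_eq_reverse f, Φ.τ₀_τ₀]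
  simp [antipode, Φ.τ₀_τ₀]

theorem antipode_τ₁ (f : F) : Φ.antipode (Φ.τ₁ f) = Φ.τ₁ (Φ.antipode f) := by
  rw [Φ.antipode_eq_reverse (Φ.τ₁ f)]
  simp [antipode, Φ.τ₁_τ₁]

theorem inward_antipode (f : F) : Φ.inward (Φ.antipode f) = Φ.inward f := by
  simp [antipode, Φ.inward_τ₀, Φ.inward_τ₁]

theorem positive_antipode (f : F) : Φ.positive (Φ.antipode f) = Φ.positive f := by
  simp [antipode, Φ.positive_τ₀, Φ.positive_τ₁]

theorem τ₂_ne (f : F) : Φ.τ₂ f ≠ f := by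
  intro h
  have := Φ.into_τ₂ f
  rw [h] at this
  simp at this

theorem joint_τ₁ (f : F) : Φ.joint (Φ.τ₁ f) = Φ.joint f :=
  Eq.symm (Quot.sound (r := fun x y : F => y = Φ.τ₁ x ∨ y = Φ.τ₂ x) (Or.inl rfl))

theorem joint_τ₂ (f : F) : Φ.joint (Φ.τ₂ f) = Φ.joint f :=
  Eq.symm (Quot.sound (r := fun x y : F => y = Φ.τ₁ x ∨ y = Φ.τ₂ x) (Or.inr rfl))

theorem joint_τ₀_τ₂ (f : F) : Φ.joint (Φ.τ₀ (Φ.τ₂ f)) = Φ.joint (Φ.τ₀ f) := by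
  rw [Φ.τ₀_τ₂, joint_τ₂]

theorem joint_τ₀_τ₁ (f : F) : Φ.joint (Φ.τ₀ (Φ.τ₁ f)) = Φ.joint (Φ.antipode (Φ.τ₀ f)) := by
  simp [antipode, Φ.τ₀_τ₀, joint_τ₁]

theorem quad_τ₀ (f : F) : Φ.quad (Φ.τ₀ f) = Φ.quad f :=
  Eq.symm (Quot.sound (r := fun x y : F => y = Φ.τ₀ x ∨ y = Φ.τ₁ x) (Or.inl rfl))

theorem quad_τ₁ (f : F) : Φ.quad (Φ.τ₁ f) = Φ.quad f :=
  Eq.symm (Quot.sound (r := fun x y : F => y = Φ.τ₀ x ∨ y = Φ.τ₁ x) (Or.inr rfl))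

theorem edge_τ₀ (f : F) : Φ.edge (Φ.τ₀ f) = Φ.edge f :=
  Eq.symm (Quot.sound (r := fun x y : F => y = Φ.τ₀ x ∨ y = Φ.τ₂ x) (Or.inl rfl))

theorem quad_antipode (f : F) : Φ.quad (Φ.antipode f) = Φ.quad f := by
  simp [antipode, quad_τ₀, quad_τ₁]

theorem inward_eq_of_joint_eq {f g : F} (h : Φ.joint f = Φ.joint g) :
    Φ.inward f = Φ.inward g :=
  congrArg (Quot.lift Φ.inward (by
    rintro a b (rfl | rfl) <;> simp [Φ.inward_τ₁, Φ.inward_τ₂])) h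

theorem eq_of_edge_eq {f g : F} (h : Φ.edge f = Φ.edge g) :
    g = f ∨ g = Φ.τ₀ f ∨ g = Φ.τ₂ f ∨ g = Φ.τ₀ (Φ.τ₂ f) := by
  have key := congrArg (Quot.lift
    (fun x => ({x, Φ.τ₀ x, Φ.τ₂ x, Φ.τ₀ (Φ.τ₂ x)} : Set F)) (by
      rintro a b (rfl | rfl) <;> ext y <;>
        simp only [Set.mem_insert_iff, Set.mem_singleton_iff, Φ.τ₀_τ₀, Φ.τ₂_τ₂, Φ.τ₀_τ₂] <;>
        tauto)) h
  have hg : g ∈ ({g, Φ.τ₀ g, Φ.τ₂ g, Φ.τ₀ (Φ.τ₂ g)} : Set F) := by simp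
  have : g ∈ ({f, Φ.τ₀ f, Φ.τ₂ f, Φ.τ₀ (Φ.τ₂ f)} : Set F) := (Set.ext_iff.1 key g).2 hg
  simpa using this

theorem eq_of_edge_eq_of_inward_eq {f g : F} (h : Φ.edge f = Φ.edge g)
    (hi : Φ.inward f = Φ.inward g) : g = f ∨ g = Φ.τ₂ f := by
  rcases Φ.eq_of_edge_eq h with h | h | h | h
  · exact Or.inl h
  · simp [h, Φ.inward_τ₀] at hi
  · exact Or.inr h
  · simp [h, Φ.inward_τ₀, Φ.inward_τ₂] at hi

theorem eq_of_quad_eq {f g : F} (h : Φ.quad f = Φ.quad g) :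
    ∃ x, (x = f ∨ x = Φ.τ₀ f ∨ x = Φ.τ₁ f ∨ x = Φ.τ₁ (Φ.τ₀ f)) ∧ (g = x ∨ g = Φ.antipode x) := by
  have e (x : F) : Φ.τ₀ (Φ.τ₁ x) = Φ.antipode (Φ.τ₁ (Φ.τ₀ x)) := by
    simp [Φ.antipode_eq_reverse, Φ.τ₀_τ₀, Φ.τ₁_τ₁]
  have key := congrArg (Quot.lift
    (fun x => ({x, Φ.τ₀ x, Φ.τ₁ x, Φ.τ₁ (Φ.τ₀ x), Φ.antipode x, Φ.antipode (Φ.τ₀ x),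
      Φ.antipode (Φ.τ₁ x), Φ.antipode (Φ.τ₁ (Φ.τ₀ x))} : Set F)) (by
      rintro a b (rfl | rfl) <;> ext y <;>
        simp only [Set.mem_insert_iff, Set.mem_singleton_iff, Φ.τ₀_τ₀, Φ.τ₁_τ₁, e,
          Φ.antipode_τ₁, Φ.antipode_τ₀, Φ.antipode_antipode] <;>
        tauto)) h
  have hg : g ∈ ({g, Φ.τ₀ g, Φ.τ₁ g, Φ.τ₁ (Φ.τ₀ g), Φ.antipode g, Φ.antipode (Φ.τ₀ g),
      Φ.antipode (Φ.τ₁ g), Φ.antipode (Φ.τ₁ (Φ.τ₀ g))} : Set F) := by simp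
  have : g ∈ ({f, Φ.τ₀ f, Φ.τ₁ f, Φ.τ₁ (Φ.τ₀ f), Φ.antipode f, Φ.antipode (Φ.τ₀ f),
      Φ.antipode (Φ.τ₁ f), Φ.antipode (Φ.τ₁ (Φ.τ₀ f))} : Set F) := (Set.ext_iff.1 key g).2 hg
  simp only [Set.mem_insert_iff, Set.mem_singleton_iff] at this
  simp only [or_and_right, exists_or, exists_eq_left]
  tauto

/-- A property of flags that is preserved by the three involutions holds for all flags once it
holds for one. -/
theorem forall_of_exists {P : F → Prop} (h₀ : ∀ f, P f → P (Φ.τ₀ f))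
    (h₁ : ∀ f, P f → P (Φ.τ₁ f)) (h₂ : ∀ f, P f → P (Φ.τ₂ f)) {f : F} (hf : P f) (g : F) :
    P g := by
  have h : ∀ x y, Relation.EqvGen (fun x y => y = Φ.τ₀ x ∨ y = Φ.τ₁ x ∨ y = Φ.τ₂ x) x y →
      (P x ↔ P y) := by
    intro x y hxy
    induction hxy with
    | rel x y hxy =>
      rcases hxy with rfl | rfl | rfl
      · exact ⟨h₀ x, fun h => by simpa [Φ.τ₀_τ₀] using h₀ _ h⟩
      · exact ⟨h₁ x, fun h => by simpa [Φ.τ₁_τ₁] using h₁ _ h⟩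
      · exact ⟨h₂ x, fun h => by simpa [Φ.τ₂_τ₂] using h₂ _ h⟩
    | refl x => exact Iff.rfl
    | symm x y _ ih => exact ih.symm
    | trans x y z _ _ ih₁ ih₂ => exact ih₁.trans ih₂
  exact (h f g (Φ.connected f g)).1 hf

/-! ### Local orientations at a joint -/

/-- The involution `τ₂` as a permutation of the flags. -/
def acrossPerm : Equiv.Perm F := ⟨Φ.τ₂, Φ.τ₂, Φ.τ₂_τ₂, Φ.τ₂_τ₂⟩

/-- The rotation around a joint, by one corner in the direction given by the flag. -/
def rot : Equiv.Perm F where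
  toFun f := Φ.τ₁ (Φ.τ₂ f)
  invFun f := Φ.τ₂ (Φ.τ₁ f)
  left_inv f := by simp [Φ.τ₁_τ₁, Φ.τ₂_τ₂]
  right_inv f := by simp [Φ.τ₁_τ₁, Φ.τ₂_τ₂]

/-- Two flags at the same joint define the same local orientation there: a rotation around the
joint takes one to the other. -/
def SameOrientation (f g : F) : Prop := Φ.rot.SameCycle f g

variable {Φ}

theorem SameOrientation.refl (f : F) : Φ.SameOrientation f f := Equiv.Perm.SameCycle.refl _ _

theorem SameOrientation.symm {f g : F} (h : Φ.SameOrientation f g) : Φ.SameOrientation g f :=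
  Equiv.Perm.SameCycle.symm h

theorem SameOrientation.trans {f g k : F} (h : Φ.SameOrientation f g)
    (h' : Φ.SameOrientation g k) : Φ.SameOrientation f k :=
  Equiv.Perm.SameCycle.trans h h'

theorem SameOrientation.τ₂ {f g : F} (h : Φ.SameOrientation f g) :
    Φ.SameOrientation (Φ.τ₂ f) (Φ.τ₂ g) := by
  have hc : Φ.acrossPerm * Φ.rot * Φ.acrossPerm⁻¹ = Φ.rot⁻¹ := by
    ext x
    change Φ.τ₂ (Φ.τ₁ (Φ.τ₂ (Φ.τ₂ x))) = Φ.τ₂ (Φ.τ₁ x)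
    rw [Φ.τ₂_τ₂]
  rw [SameOrientation, ← Equiv.Perm.sameCycle_inv, ← hc, Equiv.Perm.sameCycle_conj]
  change Φ.rot.SameCycle (Φ.τ₂ (Φ.τ₂ f)) (Φ.τ₂ (Φ.τ₂ g))
  rwa [Φ.τ₂_τ₂, Φ.τ₂_τ₂]

variable (Φ)

theorem sameOrientation_rot (f : F) : Φ.SameOrientation f (Φ.τ₁ (Φ.τ₂ f)) := ⟨1, by simp [rot]⟩

theorem sameOrientation_τ₂_τ₁ (f : F) : Φ.SameOrientation (Φ.τ₂ f) (Φ.τ₁ f) := by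
  simpa [Φ.τ₂_τ₂] using Φ.sameOrientation_rot (Φ.τ₂ f)

theorem sameSide_iff (f g : F) : Φ.SameSide f g ↔ Φ.SameOrientation (Φ.τ₂ f) g := by
  have : Finite F := Φ.finite
  have hrot : (fun x => Φ.τ₁ (Φ.τ₂ x)) = Φ.rot := rfl
  constructor
  · rintro ⟨j, rfl⟩
    refine (Φ.sameOrientation_τ₂_τ₁ f).trans ⟨j, ?_⟩
    rw [hrot, Equiv.Perm.iterate_eq_pow, zpow_natCast]
  · intro h
    obtain ⟨j, hj⟩ := Equiv.Perm.SameCycle.exists_nat_pow_eq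
      ((Φ.sameOrientation_τ₂_τ₁ f).symm.trans h)
    exact ⟨j, by rw [hrot, Equiv.Perm.iterate_eq_pow, hj]⟩

/-- There are at most two local orientations at a joint. -/
theorem sameOrientation_or {f g : F} (h : Φ.joint f = Φ.joint g) :
    Φ.SameOrientation f g ∨ Φ.SameOrientation f (Φ.τ₂ g) := by
  have key := congrArg (Quot.lift
    (fun x => {y | Φ.SameOrientation y x ∨ Φ.SameOrientation y (Φ.τ₂ x)}) (by
      have h₁ (a : F) : Φ.SameOrientation (Φ.τ₂ (Φ.τ₁ a)) a := by
        simpa [Φ.τ₂_τ₂] using (Φ.sameOrientation_τ₂_τ₁ a).symm.τ₂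
      have h₂ (a : F) := Φ.sameOrientation_τ₂_τ₁ a
      rintro a b (rfl | rfl) <;> ext y <;> simp only [Set.mem_ofPred_eq, Φ.τ₂_τ₂]
      · exact ⟨fun h => h.symm.imp (fun h => h.trans (h₂ a)) fun h => h.trans (h₁ a).symm,
          fun h => h.symm.imp (fun h => h.trans (h₁ a)) fun h => h.trans (h₂ a).symm⟩
      · exact or_comm)) h
  exact (Set.ext_iff.1 key f).1 (Or.inl (.refl f))

/-! ### Edges of the same sign with the same ends -/

variable {Φ}

/-- Two distinct edges of the same sign, whose flags `x` and `y` define the same orientation at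
both ends, would form a coorientable cycle. -/
theorem edge_eq_of_sameOrientation (hc : ¬ Φ.HasCoorientableCycle) {x y : F}
    (hp : Φ.positive x = Φ.positive y) (hj : Φ.joint x = Φ.joint y)
    (hj₀ : Φ.joint (Φ.τ₀ x) = Φ.joint (Φ.τ₀ y)) (h : Φ.SameOrientation x y)
    (h₀ : Φ.SameOrientation (Φ.τ₀ x) (Φ.τ₀ y)) : Φ.edge x = Φ.edge y := by
  by_contra hne
  have he₀ := Φ.edge_τ₀ y
  have hxy : Φ.joint x ≠ Φ.joint (Φ.τ₀ y) := by
    intro h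
    have := Φ.inward_eq_of_joint_eq (hj.symm.trans h)
    simp [Φ.inward_τ₀] at this
  refine hc ⟨2, (![x, Φ.τ₀ y] : Fin 2 → F), ⟨by norm_num, ?_, ?_, ?_⟩,
    ⟨(![x, Φ.τ₂ (Φ.τ₀ y)] : Fin 2 → F), ?_, ?_⟩, ?_⟩
  · change ∀ k : Fin 2, _
    intro k
    fin_cases k
    · exact hj₀
    · change Φ.joint (Φ.τ₀ (Φ.τ₀ y)) = Φ.joint x
      rw [Φ.τ₀_τ₀, hj]
  · change ∀ k l : Fin 2, _
    intro k l hkl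
    fin_cases k <;> fin_cases l
    · rfl
    · exact absurd hkl hxy
    · exact absurd hkl.symm hxy
    · rfl
  · change ∀ k l : Fin 2, _
    intro k l hkl
    fin_cases k <;> fin_cases l
    · rfl
    · exact absurd (Eq.trans hkl he₀) hne
    · exact absurd (Eq.trans (Eq.symm hkl) he₀) hne
    · rfl
  · change ∀ k : Fin 2, _
    intro k
    fin_cases k
    · exact Or.inl rfl
    · exact Or.inr rfl
  · change ∀ k : Fin 2, _
    intro k
    fin_cases k
    · change Φ.SameSide (Φ.τ₀ x) (Φ.τ₂ (Φ.τ₀ y))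
      exact (Φ.sameSide_iff _ _).2 h₀.τ₂
    · change Φ.SameSide (Φ.τ₀ (Φ.τ₂ (Φ.τ₀ y))) x
      rw [Φ.sameSide_iff, Φ.τ₀_τ₂, Φ.τ₀_τ₀, Φ.τ₂_τ₂]
      exact h.symm
  · change ∀ k l : Fin 2, _
    intro k l
    fin_cases k <;> fin_cases l <;> simp [hp, Φ.positive_τ₀]

theorem eq_of_sameOrientation (hc : ¬ Φ.HasCoorientableCycle) {x y : F}
    (hp : Φ.positive x = Φ.positive y) (hj : Φ.joint x = Φ.joint y)
    (hj₀ : Φ.joint (Φ.τ₀ x) = Φ.joint (Φ.τ₀ y)) (h : Φ.SameOrientation x y)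
    (h₀ : Φ.SameOrientation (Φ.τ₀ x) (Φ.τ₀ y)) : y = x ∨ y = Φ.τ₂ x :=
  Φ.eq_of_edge_eq_of_inward_eq (edge_eq_of_sameOrientation hc hp hj hj₀ h h₀)
    (Φ.inward_eq_of_joint_eq hj)

/-- At most two edges of a given sign join two given joints. -/
theorem mem_of_parallel (hc : ¬ Φ.HasCoorientableCycle) {x y z : F}
    (hpy : Φ.positive x = Φ.positive y) (hpz : Φ.positive x = Φ.positive z)
    (hy : Φ.joint x = Φ.joint y) (hy₀ : Φ.joint (Φ.τ₀ x) = Φ.joint (Φ.τ₀ y))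
    (hz : Φ.joint x = Φ.joint z) (hz₀ : Φ.joint (Φ.τ₀ x) = Φ.joint (Φ.τ₀ z))
    (hxy : y ≠ x) (hxy₂ : y ≠ Φ.τ₂ x) :
    z = x ∨ z = Φ.τ₂ x ∨ z = y ∨ z = Φ.τ₂ y := by
  -- Passing to `τ₂ y` and `τ₂ z` if necessary, all three flags agree in orientation at `joint x`.
  wlog hoy : Φ.SameOrientation x y generalizing y
  · have := this (y := Φ.τ₂ y) (by rwa [Φ.positive_τ₂]) (by rwa [joint_τ₂])
      (by rwa [joint_τ₀_τ₂]) (fun h => hxy₂ (by rw [← h, Φ.τ₂_τ₂]))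
      (fun h => hxy (by rw [← Φ.τ₂_τ₂ y, h, Φ.τ₂_τ₂]))
      ((Φ.sameOrientation_or hy).resolve_left hoy)
    rw [Φ.τ₂_τ₂] at this
    tauto
  wlog hoz : Φ.SameOrientation x z generalizing z
  · have := this (z := Φ.τ₂ z) (by rwa [Φ.positive_τ₂]) (by rwa [joint_τ₂])
      (by rwa [joint_τ₀_τ₂]) ((Φ.sameOrientation_or hz).resolve_left hoz)
    have e (w : F) : Φ.τ₂ z = w ↔ z = Φ.τ₂ w :=
      ⟨fun h => by rw [← h, Φ.τ₂_τ₂], fun h => by rw [h, Φ.τ₂_τ₂]⟩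
    simp only [e, Φ.τ₂_τ₂] at this
    tauto
  have hnot : ¬ Φ.SameOrientation (Φ.τ₀ x) (Φ.τ₀ y) := fun h =>
    (eq_of_sameOrientation hc hpy hy hy₀ hoy h).elim hxy hxy₂
  have hoy₀ := (Φ.sameOrientation_or hy₀).resolve_left hnot
  -- At the other end, two of the three flags agree by the pigeonhole principle.
  rcases Φ.sameOrientation_or hz₀ with h | h
  · have := eq_of_sameOrientation hc hpz hz hz₀ hoz h
    tauto
  · have h' : Φ.SameOrientation (Φ.τ₀ y) (Φ.τ₀ z) := by
      simpa [Φ.τ₂_τ₂] using (hoy₀.symm.trans h).τ₂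
    have := eq_of_sameOrientation hc (hpy.symm.trans hpz) (hy.symm.trans hz) (hy₀.symm.trans hz₀)
      (hoy.symm.trans hoz) h'
    tauto

/-! ### The projective plane -/

/-- If a side of a quadrilateral is glued to the opposite one, the adjacent sides form the boundary
of a Möbius band, so they are glued to each other, too. -/
theorem antipode_eq_τ₂_τ₁ (hc : ¬ Φ.HasCoorientableCycle) {f : F} (hf : Φ.antipode f = Φ.τ₂ f) :
    Φ.antipode (Φ.τ₁ f) = Φ.τ₂ (Φ.τ₁ f) := by
  have e₁ : Φ.antipode (Φ.τ₁ f) = Φ.τ₁ (Φ.τ₂ f) := by rw [antipode_τ₁, hf]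
  have e₂ : Φ.τ₀ (Φ.τ₁ f) = Φ.τ₁ (Φ.τ₂ (Φ.τ₀ f)) := by
    rw [← Φ.τ₀_τ₂, ← hf, ← antipode_τ₀]
    simp [antipode, Φ.τ₀_τ₀, Φ.τ₁_τ₁]
  have e₃ : Φ.τ₀ (Φ.antipode (Φ.τ₁ f)) = Φ.τ₁ (Φ.τ₀ f) := by
    simp [antipode_eq_reverse, Φ.τ₀_τ₀, Φ.τ₁_τ₁]
  have ho : Φ.SameOrientation (Φ.τ₁ f) (Φ.τ₂ (Φ.antipode (Φ.τ₁ f))) := by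
    rw [e₁]
    exact (Φ.sameOrientation_τ₂_τ₁ f).symm.trans (Φ.sameOrientation_rot f).τ₂
  have ho₀ : Φ.SameOrientation (Φ.τ₀ (Φ.τ₁ f)) (Φ.τ₀ (Φ.τ₂ (Φ.antipode (Φ.τ₁ f)))) := by
    rw [Φ.τ₀_τ₂, e₃, e₂]
    refine (Φ.sameOrientation_rot _).symm.trans ?_
    simpa [Φ.τ₂_τ₂] using (Φ.sameOrientation_τ₂_τ₁ (Φ.τ₀ f)).τ₂
  rcases eq_of_sameOrientation hc (by simp [Φ.positive_τ₂, positive_antipode])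
    (by rw [e₁]; simp [joint_τ₁, joint_τ₂])
    (by rw [joint_τ₀_τ₂, e₃, e₂]; simp [joint_τ₁, joint_τ₂]) ho ho₀ with h | h
  · rw [← Φ.τ₂_τ₂ (Φ.antipode _), h]
  · exact absurd (by rw [← Φ.τ₂_τ₂ (Φ.antipode _), h, Φ.τ₂_τ₂]) (Φ.antipode_ne (Φ.τ₁ f))

theorem iso_oneQP (hc : ¬ Φ.HasCoorientableCycle) {f : F} (hf : Φ.antipode f = Φ.τ₂ f) :
    Φ.Iso oneQP := by
  have hall : ∀ x, Φ.antipode x = Φ.τ₂ x := fun x =>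
    Φ.forall_of_exists (P := fun x => Φ.antipode x = Φ.τ₂ x)
      (fun x h => by rw [antipode_τ₀, h, Φ.τ₀_τ₂]) (fun x h => antipode_eq_τ₂_τ₁ hc h)
      (fun x h => by rw [← h, antipode_antipode, h, Φ.τ₂_τ₂]) hf x
  obtain ⟨g, hgi, hgp⟩ : ∃ g, Φ.inward g = true ∧ Φ.positive g = true := by
    obtain ⟨g, hg⟩ : ∃ g, Φ.positive g = true := by
      cases h : Φ.positive f
      · exact ⟨Φ.τ₁ f, by simp [Φ.positive_τ₁, h]⟩
      · exact ⟨f, h⟩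
    cases h : Φ.inward g
    · exact ⟨Φ.τ₀ g, by simp [Φ.inward_τ₀, h], by simp [Φ.positive_τ₀, hg]⟩
    · exact ⟨g, h, hg⟩
  let e : Fin 8 → F := ![g, Φ.τ₀ g, Φ.τ₁ (Φ.τ₀ g), Φ.τ₀ (Φ.τ₁ (Φ.τ₀ g)), Φ.antipode g,
    Φ.τ₀ (Φ.antipode g), Φ.τ₁ (Φ.τ₀ (Φ.antipode g)), Φ.τ₀ (Φ.τ₁ (Φ.τ₀ (Φ.antipode g)))]
  have h₀ : ∀ i, e (oneQP.τ₀ i) = Φ.τ₀ (e i) := by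
    intro i
    fin_cases i <;> simp [e, oneQP, sq₀, Φ.τ₀_τ₀]
  have h₁ : ∀ i, e (oneQP.τ₁ i) = Φ.τ₁ (e i) := by
    intro i
    fin_cases i
    · change Φ.τ₀ (Φ.τ₁ (Φ.τ₀ (Φ.antipode g))) = Φ.τ₁ g
      simp [antipode_eq_reverse, Φ.τ₀_τ₀, Φ.τ₁_τ₁]
    · rfl
    · exact (Φ.τ₁_τ₁ _).symm
    · rfl
    · exact (Φ.τ₁_τ₁ _).symm
    · rfl
    · exact (Φ.τ₁_τ₁ _).symm
    · exact (Φ.antipode_antipode g).symm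
  have h₂ : ∀ i, e (oneQP.τ₂ i) = Φ.τ₂ (e i) := by
    intro i
    rw [← hall]
    fin_cases i <;>
      simp [e, oneQP, antipode_τ₀, antipode_τ₁, antipode_antipode]
  have hi : ∀ i, Φ.inward (e i) = oneQP.inward i := by
    intro i
    fin_cases i <;>
      simp [e, oneQP, Φ.inward_τ₀, Φ.inward_τ₁, inward_antipode, hgi]
  have hp : ∀ i, Φ.positive (e i) = oneQP.positive i := by
    intro i
    fin_cases i <;>
      simp [e, oneQP, Φ.positive_τ₀, Φ.positive_τ₁, positive_antipode, hgp]
  have hinj : Function.Injective e := by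
    intro i j hij
    have hi' : oneQP.inward i = oneQP.inward j := by rw [← hi, ← hi, hij]
    have hp' : oneQP.positive i = oneQP.positive j := by rw [← hp, ← hp, hij]
    have hcases : ∀ i j : Fin 8, oneQP.inward i = oneQP.inward j →
        oneQP.positive i = oneQP.positive j → i = j ∨ i = oneQP.τ₂ j := by decide
    rcases hcases i j hi' hp' with h | h
    · exact h
    · rw [h, h₂] at hij
      exact absurd hij (Φ.τ₂_ne _)
  have hsurj : Function.Surjective e := fun x =>
    Φ.forall_of_exists (P := fun x => ∃ i, e i = x)
      (by rintro _ ⟨i, rfl⟩; exact ⟨_, h₀ i⟩) (by rintro _ ⟨i, rfl⟩; exact ⟨_, h₁ i⟩)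
      (by rintro _ ⟨i, rfl⟩; exact ⟨_, h₂ i⟩) (f := g) ⟨0, rfl⟩ x
  let E := Equiv.ofBijective e ⟨hinj, hsurj⟩
  have hE : ∀ i, E i = e i := fun _ => rfl
  refine ⟨E.symm, fun x => ?_, fun x => ?_, fun x => ?_, fun x => ?_, fun x => ?_⟩ <;>
    obtain ⟨i, rfl⟩ := E.surjective x
  · rw [Equiv.symm_apply_eq, Equiv.symm_apply_apply, hE, hE, h₀]
  · rw [Equiv.symm_apply_eq, Equiv.symm_apply_apply, hE, hE, h₁]
  · rw [Equiv.symm_apply_eq, Equiv.symm_apply_apply, hE, hE, h₂]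
  · rw [Equiv.symm_apply_apply, hE, hi]
  · rw [Equiv.symm_apply_apply, hE, hp]

/-! ### Neighbours of a totally rigid quadrilateral -/

variable (Φ) in
/-- The corner of the flag and the opposite corner of its quadrilateral lie at the same joint. -/
def Pinched (f : F) : Prop := Φ.joint (Φ.antipode f) = Φ.joint f

theorem pinched_τ₁ {f : F} : Φ.Pinched (Φ.τ₁ f) ↔ Φ.Pinched f := by
  simp [Pinched, antipode_τ₁, joint_τ₁]

theorem pinched_antipode {f : F} : Φ.Pinched (Φ.antipode f) ↔ Φ.Pinched f := by
  rw [Pinched, Pinched, antipode_antipode, eq_comm]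

theorem pinched_τ₀_τ₁ {f : F} : Φ.Pinched (Φ.τ₀ (Φ.τ₁ f)) ↔ Φ.Pinched (Φ.τ₀ f) := by
  rw [← pinched_antipode (f := Φ.τ₀ f), ← pinched_τ₁ (f := Φ.τ₀ (Φ.τ₁ f))]
  simp [antipode, Φ.τ₀_τ₀]

/-- A neighbour of a totally rigid quadrilateral, across the side of `f`, that has a single joint
opposite to the joint of `f` is glued to the other side at the opposite corner. -/
theorem rot_eq_of_neighbour (hc : ¬ Φ.HasCoorientableCycle)
    (hg : ∀ f, Φ.antipode f ≠ Φ.τ₂ f) {f : F} (hf : Φ.Pinched f) (hf₀ : Φ.Pinched (Φ.τ₀ f))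
    (hn : Φ.Pinched (Φ.τ₀ (Φ.τ₂ f))) : Φ.τ₁ (Φ.τ₂ f) = Φ.τ₂ (Φ.τ₁ (Φ.antipode f)) := by
  have hk : Φ.Pinched (Φ.τ₁ f) := pinched_τ₁.2 hf
  have hk₀ : Φ.Pinched (Φ.τ₀ (Φ.τ₁ f)) := pinched_τ₀_τ₁.2 hf₀
  rcases mem_of_parallel hc (x := Φ.τ₁ f) (y := Φ.antipode (Φ.τ₁ f)) (z := Φ.τ₁ (Φ.τ₂ f))
    (Φ.positive_antipode _).symm (by simp [Φ.positive_τ₁, Φ.positive_τ₂])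
    hk.symm (by rw [← antipode_τ₀]; exact hk₀.symm) (by simp [joint_τ₁, joint_τ₂])
    (by rw [joint_τ₀_τ₁, joint_τ₀_τ₁, hf₀, hn, joint_τ₀_τ₂])
    (Φ.antipode_ne _) (hg _) with h | h | h | h
  · have := congrArg Φ.τ₁ h
    rw [Φ.τ₁_τ₁, Φ.τ₁_τ₁] at this
    exact absurd this (Φ.τ₂_ne f)
  · -- Here the joint is surrounded by two corners only, and the opposite corner is not among them.
    exfalso
    have key := congrArg (Quot.lift
      (fun x => x = f ∨ x = Φ.τ₁ f ∨ x = Φ.τ₂ f ∨ x = Φ.τ₁ (Φ.τ₂ f)) (by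
        have e₁ (a b : F) : Φ.τ₁ a = b ↔ a = Φ.τ₁ b :=
          ⟨fun h => by rw [← h, Φ.τ₁_τ₁], fun h => by rw [h, Φ.τ₁_τ₁]⟩
        have e₂ (a b : F) : Φ.τ₂ a = b ↔ a = Φ.τ₂ b :=
          ⟨fun h => by rw [← h, Φ.τ₂_τ₂], fun h => by rw [h, Φ.τ₂_τ₂]⟩
        rintro a b (rfl | rfl)
        · simp only [e₁, Φ.τ₁_τ₁]
          apply propext
          tauto
        · have h' : Φ.τ₂ (Φ.τ₁ (Φ.τ₂ f)) = Φ.τ₁ f := by rw [h, Φ.τ₂_τ₂]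
          simp only [e₂, Φ.τ₂_τ₂, h', ← h]
          apply propext
          tauto)) hf
    have hmem := key.mpr (Or.inl rfl)
    rcases hmem with h | h | h | h
    · exact Φ.antipode_ne f h
    · have := congrArg Φ.positive h
      simp [positive_antipode, Φ.positive_τ₁] at this
    · exact hg f h
    · have := congrArg Φ.positive h
      simp [positive_antipode, Φ.positive_τ₁, Φ.positive_τ₂] at this
  · rw [antipode_τ₁] at h
    have := congrArg Φ.τ₁ h
    rw [Φ.τ₁_τ₁, Φ.τ₁_τ₁] at this
    exact absurd this.symm (hg f)
  · rw [h, antipode_τ₁]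

theorem sameOrientation_of_neighbour (hc : ¬ Φ.HasCoorientableCycle)
    (hg : ∀ f, Φ.antipode f ≠ Φ.τ₂ f) {f : F} (hf : Φ.Pinched f) (hf₀ : Φ.Pinched (Φ.τ₀ f))
    (hn : Φ.Pinched (Φ.τ₀ (Φ.τ₂ f))) : Φ.SameOrientation f (Φ.antipode f) := by
  have h := Φ.sameOrientation_rot f
  rw [rot_eq_of_neighbour hc hg hf hf₀ hn] at h
  refine h.trans ?_
  simpa [Φ.τ₂_τ₂] using (Φ.sameOrientation_τ₂_τ₁ (Φ.antipode f)).symm.τ₂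

theorem not_sameOrientation (hc : ¬ Φ.HasCoorientableCycle)
    (hg : ∀ f, Φ.antipode f ≠ Φ.τ₂ f) {f : F} (hf : Φ.Pinched f) (hf₀ : Φ.Pinched (Φ.τ₀ f))
    (h : Φ.SameOrientation f (Φ.antipode f))
    (h₀ : Φ.SameOrientation (Φ.τ₀ f) (Φ.antipode (Φ.τ₀ f))) : False := by
  rw [antipode_τ₀] at h₀
  rcases eq_of_sameOrientation hc (Φ.positive_antipode f).symm hf.symm
    (by rw [← antipode_τ₀]; exact hf₀.symm) h h₀ with h | h
  · exact Φ.antipode_ne f h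
  · exact hg f h

theorem not_pinched_of_pinched (hc : ¬ Φ.HasCoorientableCycle)
    (hg : ∀ f, Φ.antipode f ≠ Φ.τ₂ f) {f : F} (hf : Φ.Pinched f) (hf₀ : Φ.Pinched (Φ.τ₀ f))
    (hn : Φ.Pinched (Φ.τ₀ (Φ.τ₂ f))) : ¬ Φ.Pinched (Φ.τ₂ f) := by
  intro hn₀
  refine not_sameOrientation hc hg hf hf₀ (sameOrientation_of_neighbour hc hg hf hf₀ hn)
    (sameOrientation_of_neighbour hc hg hf₀ (by rwa [Φ.τ₀_τ₀]) ?_)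
  rwa [← Φ.τ₀_τ₂, Φ.τ₀_τ₀]

theorem not_pinched_antipode_of_pinched (hc : ¬ Φ.HasCoorientableCycle)
    (hg : ∀ f, Φ.antipode f ≠ Φ.τ₂ f) {f : F} (hf : Φ.Pinched f) (hf₀ : Φ.Pinched (Φ.τ₀ f))
    (hn : Φ.Pinched (Φ.τ₀ (Φ.τ₂ f))) : ¬ Φ.Pinched (Φ.τ₂ (Φ.antipode f)) := by
  intro hn₀
  have h := sameOrientation_of_neighbour hc hg (f := Φ.τ₀ (Φ.antipode f))
    (by rwa [← antipode_τ₀, pinched_antipode]) (by rwa [Φ.τ₀_τ₀, pinched_antipode])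
    (by rwa [← Φ.τ₀_τ₂, Φ.τ₀_τ₀])
  rw [antipode_τ₀, antipode_antipode, ← antipode_τ₀] at h
  exact not_sameOrientation hc hg hf hf₀ (sameOrientation_of_neighbour hc hg hf hf₀ hn) h.symm

/-- If the neighbours across two opposite sides of a totally rigid quadrilateral both have a single
outward joint, say, then no neighbour across the remaining sides has a single inward joint: it is
also the neighbour across one of these two opposite sides. -/
theorem not_pinched_τ₁_of_pinched (hc : ¬ Φ.HasCoorientableCycle)
    (hg : ∀ f, Φ.antipode f ≠ Φ.τ₂ f) {f : F} (hf : Φ.Pinched f) (hf₀ : Φ.Pinched (Φ.τ₀ f))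
    (hn : Φ.Pinched (Φ.τ₀ (Φ.τ₂ f)))
    (ha : Φ.Pinched (Φ.τ₀ (Φ.τ₂ (Φ.antipode f)))) :
    ¬ Φ.Pinched (Φ.τ₂ (Φ.τ₁ f)) := by
  have h := rot_eq_of_neighbour hc hg (f := Φ.antipode f) (pinched_antipode.2 hf)
    (by rwa [← antipode_τ₀, pinched_antipode]) ha
  rw [antipode_antipode] at h
  rw [← h, pinched_τ₁]
  exact not_pinched_antipode_of_pinched hc hg hf hf₀ hn

/-! ### Rigid quadrilaterals -/

theorem inwardJointsOf_quad {f : F} (hf : Φ.inward f = true) :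
    Φ.inwardJointsOf (Φ.quad f) = {Φ.joint f, Φ.joint (Φ.antipode f)} := by
  ext j
  simp only [inwardJointsOf, Set.mem_ofPred_eq, Set.mem_insert_iff, Set.mem_singleton_iff]
  constructor
  · rintro ⟨g, hq, rfl, hi⟩
    obtain ⟨x, hx, hgx⟩ := Φ.eq_of_quad_eq hq.symm
    rcases hgx with rfl | rfl <;> rcases hx with rfl | rfl | rfl | rfl <;>
      simp_all [Φ.inward_τ₀, Φ.inward_τ₁, inward_antipode, antipode_τ₁, joint_τ₁]
  · rintro (rfl | rfl)
    · exact ⟨f, rfl, rfl, hf⟩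
    · exact ⟨_, Φ.quad_antipode f, rfl, by rwa [inward_antipode]⟩

theorem outwardJointsOf_quad {f : F} (hf : Φ.inward f = false) :
    Φ.outwardJointsOf (Φ.quad f) = {Φ.joint f, Φ.joint (Φ.antipode f)} := by
  ext j
  simp only [outwardJointsOf, Set.mem_ofPred_eq, Set.mem_insert_iff, Set.mem_singleton_iff]
  constructor
  · rintro ⟨g, hq, rfl, hi⟩
    obtain ⟨x, hx, hgx⟩ := Φ.eq_of_quad_eq hq.symm
    rcases hgx with rfl | rfl <;> rcases hx with rfl | rfl | rfl | rfl <;>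
      simp_all [Φ.inward_τ₀, Φ.inward_τ₁, inward_antipode, antipode_τ₁, joint_τ₁]
  · rintro (rfl | rfl)
    · exact ⟨f, rfl, rfl, hf⟩
    · exact ⟨_, Φ.quad_antipode f, rfl, by rwa [inward_antipode]⟩

theorem inwardJointsOf_subsingleton_iff {f : F} (hf : Φ.inward f = true) :
    (Φ.inwardJointsOf (Φ.quad f)).Subsingleton ↔ Φ.Pinched f := by
  rw [inwardJointsOf_quad hf, Pinched]
  refine ⟨fun h => h (by simp) (by simp), fun h => ?_⟩
  rw [h, Set.pair_eq_singleton]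
  exact Set.subsingleton_singleton

theorem outwardJointsOf_subsingleton_iff {f : F} (hf : Φ.inward f = false) :
    (Φ.outwardJointsOf (Φ.quad f)).Subsingleton ↔ Φ.Pinched f := by
  rw [outwardJointsOf_quad hf, Pinched]
  refine ⟨fun h => h (by simp) (by simp), fun h => ?_⟩
  rw [h, Set.pair_eq_singleton]
  exact Set.subsingleton_singleton

theorem exists_inward_quad (Q : Φ.Quad) : ∃ f, Φ.quad f = Q ∧ Φ.inward f = true := by
  obtain ⟨f, rfl⟩ := Quot.exists_rep Q
  cases h : Φ.inward f
  · exact ⟨Φ.τ₀ f, Φ.quad_τ₀ f, by simp [Φ.inward_τ₀, h]⟩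
  · exact ⟨f, rfl, h⟩

theorem isOutwardlyRigidQuad_iff {f : F} (hf : Φ.inward f = true) :
    Φ.IsOutwardlyRigidQuad (Φ.quad f) ↔ ¬ Φ.Pinched f ∧ Φ.Pinched (Φ.τ₀ f) := by
  rw [IsOutwardlyRigidQuad, ← Set.not_subsingleton_iff, inwardJointsOf_subsingleton_iff hf,
    ← Φ.quad_τ₀ f, outwardJointsOf_subsingleton_iff (by simp [Φ.inward_τ₀, hf])]

theorem isInwardlyRigidQuad_iff {f : F} (hf : Φ.inward f = true) :
    Φ.IsInwardlyRigidQuad (Φ.quad f) ↔ Φ.Pinched f ∧ ¬ Φ.Pinched (Φ.τ₀ f) := by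
  rw [IsInwardlyRigidQuad, ← Set.not_subsingleton_iff, inwardJointsOf_subsingleton_iff hf,
    ← Φ.quad_τ₀ f, outwardJointsOf_subsingleton_iff (by simp [Φ.inward_τ₀, hf])]

theorem isFree_iff {f : F} (hf : Φ.inward f = true) :
    Φ.IsFree (Φ.quad f) ↔ ¬ Φ.Pinched f ∧ ¬ Φ.Pinched (Φ.τ₀ f) := by
  rw [IsFree, ← Set.not_subsingleton_iff, ← Set.not_subsingleton_iff,
    inwardJointsOf_subsingleton_iff hf,
    ← Φ.quad_τ₀ f, outwardJointsOf_subsingleton_iff (by simp [Φ.inward_τ₀, hf])]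

/-- If every quadrilateral has a single outward joint, then so has the surface. -/
theorem isOutwardlyRigid_of_forall
    (hout : ∀ f, Φ.inward f = false → Φ.Pinched f)
    (hex : ∃ Q, Φ.IsOutwardlyRigidQuad Q) : Φ.IsOutwardlyRigid := by
  have : Finite F := Φ.finite
  have : Finite Φ.Joint := Quot.finite _
  have hsub : ∀ Q, (Φ.outwardJointsOf Q).Subsingleton := by
    intro Q
    obtain ⟨f, rfl, hf⟩ := exists_inward_quad Q
    have hf₀ : Φ.inward (Φ.τ₀ f) = false := by simp [Φ.inward_τ₀, hf]
    rw [← Φ.quad_τ₀ f, outwardJointsOf_subsingleton_iff hf₀]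
    exact hout _ hf₀
  obtain ⟨Q₀, hQ₀⟩ := hex
  refine ⟨fun Q => ?_, ⟨Q₀, hQ₀⟩, ?_, ?_⟩
  · rcases Set.subsingleton_or_nontrivial (Φ.inwardJointsOf Q) with h | h
    · exact Or.inr ⟨h, hsub Q⟩
    · exact Or.inl ⟨h, hsub Q⟩
  · obtain ⟨g, -, hg⟩ := exists_inward_quad Q₀
    -- The outward joint of the edge of a flag does not depend on the flag.
    have key : ∀ x, (Φ.inward x = true → Φ.joint (Φ.τ₀ x) = Φ.joint (Φ.τ₀ g)) ∧
        (Φ.inward x = false → Φ.joint x = Φ.joint (Φ.τ₀ g)) := by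
      refine Φ.forall_of_exists (fun x h => ⟨fun hx => ?_, fun hx => ?_⟩)
        (fun x h => ⟨fun hx => ?_, fun hx => ?_⟩) (fun x h => ⟨fun hx => ?_, fun hx => ?_⟩)
        (f := g) ⟨fun _ => rfl, fun h => by simp [hg] at h⟩
      · rw [Φ.τ₀_τ₀]
        exact h.2 (by simpa [Φ.inward_τ₀] using hx)
      · exact h.1 (by simpa [Φ.inward_τ₀] using hx)
      · rw [Φ.inward_τ₁] at hx
        rw [joint_τ₀_τ₁, hout _ (by simp [Φ.inward_τ₀, hx])]
        exact h.1 hx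
      · rw [joint_τ₁]
        exact h.2 (by simpa [Φ.inward_τ₁] using hx)
      · rw [joint_τ₀_τ₂]
        exact h.1 (by simpa [Φ.inward_τ₂] using hx)
      · rw [joint_τ₂]
        exact h.2 (by simpa [Φ.inward_τ₂] using hx)
    rw [Set.ncard_eq_one]
    refine ⟨Φ.joint (Φ.τ₀ g), Set.eq_singleton_iff_unique_mem.2
      ⟨⟨_, rfl, by simp [Φ.inward_τ₀, hg]⟩, ?_⟩⟩
    rintro _ ⟨x, rfl, hx⟩
    exact (key x).2 hx
  · have hnt : Φ.inwardJoints.Nontrivial :=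
      hQ₀.1.mono fun j ⟨f, _, hj, hi⟩ => ⟨f, hj, hi⟩
    exact Set.one_lt_ncard_iff_nontrivial.2 hnt

/-- Outward rigidity of a quadrilateral spreads over the whole surface. -/
theorem isOutwardlyRigid_of_exists (hc : ¬ Φ.HasCoorientableCycle)
    (hg : ∀ f, Φ.antipode f ≠ Φ.τ₂ f)
    (hfree : ¬ ∃ Q, Φ.IsFree Q)
    (hadj : ¬ ∃ Qp Qm, Φ.IsOutwardlyRigidQuad Qp ∧ Φ.IsInwardlyRigidQuad Qm ∧ Φ.ShareSide Qp Qm)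
    (hex : ∃ Q, Φ.IsOutwardlyRigidQuad Q) : Φ.IsOutwardlyRigid := by
  have hnf : ∀ f, Φ.Pinched f ∨ Φ.Pinched (Φ.τ₀ f) := by
    intro f
    by_contra! h
    cases hf : Φ.inward f
    · refine hfree ⟨_, (isFree_iff (f := Φ.τ₀ f) (by simp [Φ.inward_τ₀, hf])).2 ⟨h.2, ?_⟩⟩
      rw [Φ.τ₀_τ₀]
      exact h.1
    · exact hfree ⟨_, (isFree_iff hf).2 h⟩
  have hna : ∀ f, Φ.inward f = true → ¬ Φ.Pinched f → Φ.Pinched (Φ.τ₀ (Φ.τ₂ f)) := by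
    intro f hf h
    by_contra h'
    have hf₂ : Φ.inward (Φ.τ₂ f) = true := by rwa [Φ.inward_τ₂]
    exact hadj ⟨_, _, (isOutwardlyRigidQuad_iff hf).2 ⟨h, (hnf f).resolve_left h⟩,
      (isInwardlyRigidQuad_iff hf₂).2 ⟨(hnf _).resolve_right h', h'⟩, f, rfl, rfl⟩
  -- The quadrilateral of an inward flag `x` is outwardly rigid, or it is totally rigid and all its
  -- neighbours are outwardly rigid.
  let R : F → Prop := fun x => Φ.Pinched (Φ.τ₀ x) ∧ (Φ.Pinched x →
    ¬ Φ.Pinched (Φ.τ₂ x) ∧ ¬ Φ.Pinched (Φ.τ₂ (Φ.antipode x)) ∧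
    ¬ Φ.Pinched (Φ.τ₂ (Φ.τ₁ x)) ∧ ¬ Φ.Pinched (Φ.τ₂ (Φ.antipode (Φ.τ₁ x))))
  have hR₁ : ∀ x, R x → R (Φ.τ₁ x) := by
    rintro x ⟨h, h'⟩
    refine ⟨pinched_τ₀_τ₁.2 h, fun hx => ?_⟩
    obtain ⟨a, b, c, d⟩ := h' (pinched_τ₁.1 hx)
    refine ⟨c, d, by rwa [Φ.τ₁_τ₁], by rwa [Φ.τ₁_τ₁]⟩
  have hR₂ : ∀ x, Φ.inward x = true → R x → R (Φ.τ₂ x) := by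
    rintro x hxi ⟨h, h'⟩
    by_cases hx : Φ.Pinched x
    · obtain ⟨a, -⟩ := h' hx
      exact ⟨(hnf _).resolve_left a, fun ha => absurd ha a⟩
    · have hn := hna x hxi hx
      refine ⟨hn, fun hT => ?_⟩
      have hn' : Φ.Pinched (Φ.τ₀ (Φ.τ₂ (Φ.τ₂ x))) := by rwa [Φ.τ₂_τ₂]
      have hA := not_pinched_antipode_of_pinched hc hg hT hn hn'
      have hA' := (hnf _).resolve_left hA
      have hB := not_pinched_τ₁_of_pinched hc hg hT hn hn' hA'
      refine ⟨by rwa [Φ.τ₂_τ₂], hA, hB, ?_⟩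
      have := not_pinched_antipode_of_pinched hc hg (f := Φ.τ₁ (Φ.τ₂ x)) (pinched_τ₁.2 hT)
        (pinched_τ₀_τ₁.2 hn) ((hnf _).resolve_left hB)
      exact this
  have hR₀ : ∀ x, R x → R (Φ.antipode x) := by
    rintro x ⟨h, h'⟩
    refine ⟨by rwa [← antipode_τ₀, pinched_antipode], fun hx => ?_⟩
    obtain ⟨a, b, c, d⟩ := h' (pinched_antipode.1 hx)
    rw [antipode_τ₁] at d
    refine ⟨b, by rwa [antipode_antipode], d, ?_⟩
    rwa [antipode_τ₁, antipode_antipode]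
  have key : ∀ x, (Φ.inward x = true → R x) ∧ (Φ.inward x = false → R (Φ.τ₀ x)) := by
    obtain ⟨Q, hQ⟩ := hex
    obtain ⟨g, rfl, hgi⟩ := exists_inward_quad Q
    rw [isOutwardlyRigidQuad_iff hgi] at hQ
    refine Φ.forall_of_exists (fun x h => ⟨fun hx => ?_, fun hx => ?_⟩)
      (fun x h => ⟨fun hx => ?_, fun hx => ?_⟩) (fun x h => ⟨fun hx => ?_, fun hx => ?_⟩)
      (f := g) ⟨fun _ => ⟨hQ.2, fun h => absurd h hQ.1⟩, fun h => by simp [hgi] at h⟩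
    · exact h.2 (by simpa [Φ.inward_τ₀] using hx)
    · rw [Φ.τ₀_τ₀]
      exact h.1 (by simpa [Φ.inward_τ₀] using hx)
    · exact hR₁ x (h.1 (by simpa [Φ.inward_τ₁] using hx))
    · have := hR₁ _ (hR₀ _ (h.2 (by simpa [Φ.inward_τ₁] using hx)))
      simpa [antipode, Φ.τ₀_τ₀, Φ.τ₁_τ₁] using this
    · rw [Φ.inward_τ₂] at hx
      exact hR₂ x hx (h.1 hx)
    · rw [Φ.inward_τ₂] at hx
      rw [Φ.τ₀_τ₂]
      exact hR₂ _ (by simp [Φ.inward_τ₀, hx]) (h.2 hx)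
  refine isOutwardlyRigid_of_forall (fun f hf => ?_) hex
  simpa [Φ.τ₀_τ₀] using ((key f).2 hf).1

/-! ### Reversal of the edges -/

variable (Φ) in
/-- The flow graph with the directions of all edges reversed: inward and outward joints are
exchanged. -/
def reverse : FlowGraph F :=
  { Φ with
    inward := fun f => !Φ.inward f
    inward_τ₀ := fun f => by rw [Φ.inward_τ₀]
    inward_τ₁ := fun f => by rw [Φ.inward_τ₁]
    inward_τ₂ := fun f => by rw [Φ.inward_τ₂] }

theorem inwardJointsOf_reverse (Q : Φ.Quad) :
    Φ.reverse.inwardJointsOf Q = Φ.outwardJointsOf Q := by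
  ext j
  change (∃ f, Φ.quad f = Q ∧ Φ.joint f = j ∧ (!Φ.inward f) = true) ↔
    ∃ f, Φ.quad f = Q ∧ Φ.joint f = j ∧ Φ.inward f = false
  simp

theorem outwardJointsOf_reverse (Q : Φ.Quad) :
    Φ.reverse.outwardJointsOf Q = Φ.inwardJointsOf Q := by
  ext j
  change (∃ f, Φ.quad f = Q ∧ Φ.joint f = j ∧ (!Φ.inward f) = false) ↔
    ∃ f, Φ.quad f = Q ∧ Φ.joint f = j ∧ Φ.inward f = true
  simp

theorem inwardJoints_reverse : Φ.reverse.inwardJoints = Φ.outwardJoints := by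
  ext j
  change (∃ f, Φ.joint f = j ∧ (!Φ.inward f) = true) ↔ ∃ f, Φ.joint f = j ∧ Φ.inward f = false
  simp

theorem outwardJoints_reverse : Φ.reverse.outwardJoints = Φ.inwardJoints := by
  ext j
  change (∃ f, Φ.joint f = j ∧ (!Φ.inward f) = false) ↔ ∃ f, Φ.joint f = j ∧ Φ.inward f = true
  simp

theorem isOutwardlyRigidQuad_reverse (Q : Φ.Quad) :
    Φ.reverse.IsOutwardlyRigidQuad Q ↔ Φ.IsInwardlyRigidQuad Q :=
  (and_congr (iff_of_eq (congrArg Set.Nontrivial (inwardJointsOf_reverse Q)))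
    (iff_of_eq (congrArg Set.Subsingleton (outwardJointsOf_reverse Q)))).trans and_comm

theorem isInwardlyRigidQuad_reverse (Q : Φ.Quad) :
    Φ.reverse.IsInwardlyRigidQuad Q ↔ Φ.IsOutwardlyRigidQuad Q :=
  (and_congr (iff_of_eq (congrArg Set.Subsingleton (inwardJointsOf_reverse Q)))
    (iff_of_eq (congrArg Set.Nontrivial (outwardJointsOf_reverse Q)))).trans and_comm

theorem isTotallyRigidQuad_reverse (Q : Φ.Quad) :
    Φ.reverse.IsTotallyRigidQuad Q ↔ Φ.IsTotallyRigidQuad Q :=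
  (and_congr (iff_of_eq (congrArg Set.Subsingleton (inwardJointsOf_reverse Q)))
    (iff_of_eq (congrArg Set.Subsingleton (outwardJointsOf_reverse Q)))).trans and_comm

theorem isFree_reverse (Q : Φ.Quad) :
    Φ.reverse.IsFree Q ↔ Φ.IsFree Q :=
  (and_congr (iff_of_eq (congrArg Set.Nontrivial (inwardJointsOf_reverse Q)))
    (iff_of_eq (congrArg Set.Nontrivial (outwardJointsOf_reverse Q)))).trans and_comm

theorem isInwardlyRigid_of_reverse (h : Φ.reverse.IsOutwardlyRigid) : Φ.IsInwardlyRigid := by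
  obtain ⟨h₁, ⟨Q, hQ⟩, h₃, h₄⟩ := h
  rw [outwardJoints_reverse] at h₃
  rw [inwardJoints_reverse] at h₄
  exact ⟨fun Q => (h₁ Q).imp (isOutwardlyRigidQuad_reverse (Φ := Φ) Q).1 (isTotallyRigidQuad_reverse (Φ := Φ) Q).1,
    ⟨Q, (isOutwardlyRigidQuad_reverse (Φ := Φ) Q).1 hQ⟩, h₃, h₄⟩

end FlowGraph

open FlowGraph in
theorem mainTheorem12 {F : Type*} (Φ : FlowGraph F) :
    Φ.Iso FlowGraph.oneQP ∨
    Φ.Iso FlowGraph.twoQS ∨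
    Φ.HasCoorientableCycle ∨
    (∃ Q, Φ.IsFree Q) ∨
    (∃ Qp Qm, Φ.IsOutwardlyRigidQuad Qp ∧ Φ.IsInwardlyRigidQuad Qm ∧ Φ.ShareSide Qp Qm) ∨
    Φ.IsOutwardlyRigid ∨
    Φ.IsInwardlyRigid := by
  by_cases hc : Φ.HasCoorientableCycle
  · tauto
  by_cases hg : ∃ f, Φ.antipode f = Φ.τ₂ f
  · obtain ⟨f, hf⟩ := hg
    exact Or.inl (iso_oneQP hc hf)
  by_cases hfree : ∃ Q, Φ.IsFree Q
  · tauto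
  by_cases hadj : ∃ Qp Qm,
      Φ.IsOutwardlyRigidQuad Qp ∧ Φ.IsInwardlyRigidQuad Qm ∧ Φ.ShareSide Qp Qm
  · exact Or.inr (Or.inr (Or.inr (Or.inr (Or.inl hadj))))
  by_cases hO : ∃ Q, Φ.IsOutwardlyRigidQuad Q
  · have := isOutwardlyRigid_of_exists hc (not_exists.1 hg) hfree hadj hO
    tauto
  by_cases hI : ∃ Q, Φ.IsInwardlyRigidQuad Q
  · have : Φ.reverse.IsOutwardlyRigid := by
      refine isOutwardlyRigid_of_exists (Φ := Φ.reverse) hc (not_exists.1 hg) ?_ ?_ ?_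
      · rintro ⟨Q, hQ⟩
        exact hfree ⟨Q, (isFree_reverse (Φ := Φ) Q).1 hQ⟩
      · rintro ⟨Qp, Qm, hp, hm, f, rfl, rfl⟩
        refine hadj ⟨_, _, (isInwardlyRigidQuad_reverse (Φ := Φ) _).1 hm,
          (isOutwardlyRigidQuad_reverse (Φ := Φ) _).1 hp, Φ.τ₂ f, rfl, ?_⟩
        rw [Φ.τ₂_τ₂]
        rfl
      · obtain ⟨Q, hQ⟩ := hI
        exact ⟨Q, (isOutwardlyRigidQuad_reverse (Φ := Φ) Q).2 hQ⟩
    have := isInwardlyRigid_of_reverse this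
    tauto
  -- Otherwise all quadrilaterals are totally rigid, and any two neighbours give a contradiction.
  exfalso
  have hT : ∀ f, Φ.inward f = true → Φ.Pinched f ∧ Φ.Pinched (Φ.τ₀ f) := by
    intro f hf
    have h₁ := fun h => hfree ⟨_, (isFree_iff hf).2 h⟩
    have h₂ := fun h => hO ⟨_, (isOutwardlyRigidQuad_iff hf).2 h⟩
    have h₃ := fun h => hI ⟨_, (isInwardlyRigidQuad_iff hf).2 h⟩
    tauto
  obtain ⟨f₀⟩ := Φ.nonempty
  obtain ⟨f, -, hf⟩ := exists_inward_quad (Φ.quad f₀)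
  have hf₂ := hT (Φ.τ₂ f) (by rwa [Φ.inward_τ₂])
  exact not_pinched_of_pinched hc (not_exists.1 hg) (hT f hf).1 (hT f hf).2 hf₂.2 hf₂.1
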